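/- Let $\Sigma^*$ be the set of finite binary strings. A function $r\colon\Sigma^*\to[0,1]$ is a lower-computable semi-measure if $\sum_{s}r(s)\le 1$ and there is a total recursive function $f\colon\mathbb{N}^+\times\Sigma^*\to\mathbb{Q}$ with $0\le f(n,s)\le f(n+1,s)$ and $\lim_{n\to\infty}f(n,s)=r(s)$ for all $n,s$. A lower-computable semi-measure $m$ is a universal probability if for every lower-computable semi-measure $r$ there is a real $c>0$ with $c\,r(s)\le m(s)$ for all $s\in\Sigma^*$. Let $X$ be an infinite-dimensional complex Hilbert space (inner product linear in the first variable) with a computability structure in the sense of Pour-El and Richards, i.e. a nonempty set $\varphi$ of sequences in $X$, called computable, such that: (Linear forms) if $\{x_n\},\{y_n\}\in\varphi$, $\{\alpha_{nk}\},\{\beta_{nk}\}$ are computable double sequences of complex numbers and $d\colon\mathbb{N}^+\to\mathbb{N}^+$ is total recursive, then the sequence $s_n=\sum_{k=1}^{d(n)}(\alpha_{nk}x_k+\beta_{nk}y_k)$ is in $\varphi$; (Limits) if the double sequence $\{x_{nm}\}$ is mapped to a member of $\varphi$ by a recursive bijection $\mathbb{N}^+\to\mathbb{N}^+\times\mathbb{N}^+$,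 and $\|x_{n\,e(n,k)}-y_n\|\le2^{-k}$ for all $n,k\in\mathbb{N}^+$ with $e\colon\mathbb{N}^+\times\mathbb{N}^+\to\mathbb{N}^+$ total recursive, then $\{y_n\}\in\varphi$; (Norms) if $\{x_n\}\in\varphi$, then $\{\|x_n\|\}$ is a computable sequence of real numbers. Assume that $X$ is effectively separable, i.e. that some computable sequence has dense linear span. A point $x\in X$ is computable if the constant sequence $x,x,x,\dots$ is computable. A computable orthonormal basis is a computable orthonormal sequence with dense linear span. For bounded Hermitian operators, $S\leqslant T$ means that $T-S$ is positive. A semi-POVM on $\Sigma^*$ is a map $R$ from $\Sigma^*$ to the positive bounded operators on $X$ such that $\sum_{s\in\Sigma^*}R(s)$ converges strongly to an operator $\leqslant I$. It is lower-computable if there are a computable orthonormal basis $\{e_i\}_{i\ge1}$, positive bounded operators $f(n,s)$ ($n\in\mathbb{N}^+$, $s\in\Sigma^*$) and a total recursive function $g\colon\mathbb{N}^+\times\Sigma^*\to\mathbb{N}^+$ such that: (i) for each $s$, $f(n,s)\to R(s)$ strongly as $n\to\infty$; (ii) $f(n,s)-2^{-n}I\leqslant f(n+1,s)-2^{-(n+1)}I$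 for all $n,s$; (iii) $\langle f(n,s)e_i,e_j\rangle\in\mathbb{Q}+i\mathbb{Q}$ for all $n,s,i,j$, and it is $0$ whenever $i>g(n,s)$ or $j>g(n,s)$; (iv) $(n,s,i,j)\mapsto\langle f(n,s)e_i,e_j\rangle$ is a total recursive function. A universal semi-POVM is a lower-computable semi-POVM $M$ such that for every lower-computable semi-POVM $R$ there is a real $c>0$ with $c\,R(s)\leqslant M(s)$ for all $s\in\Sigma^*$. **Theorem.** Let $M$ be a universal semi-POVM, and let $x\in X$ be computable with $\|x\|=1$. Then the mapping $\Sigma^*\ni s\mapsto\langle M(s)x,x\rangle$ is a universal probability. -/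

import Mathlib

/-- A family of rational numbers indexed by `α` is computable (a total recursive function
`α → ℚ`): sign, numerator and denominator are total recursive functions. -/
def IsComputableRat {α : Type*} [Primcodable α] (q : α → ℚ) : Prop :=
  ∃ s a b : α → ℕ, Computable s ∧ Computable a ∧ Computable b ∧
    ∀ i, b i ≠ 0 ∧ q i = (-1) ^ s i * (a i : ℚ) / (b i : ℚ)

/-- A family of complex numbers is a total recursive function with values in the
Gaussian rationals `ℚ + iℚ`. -/
def IsComputableComplexRat {α : Type*} [Primcodable α] (z : α → ℂ) : Prop :=
  ∃ p q : α → ℚ, IsComputableRat p ∧ IsComputableRat q ∧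
    ∀ i, z i = (p i : ℂ) + (q i : ℂ) * Complex.I

/-- A family of real numbers is computable: it is uniformly approximated, with error at most
`2 ^ (-k)`, by a computable family of rationals. -/
def IsComputableReal {α : Type*} [Primcodable α] (x : α → ℝ) : Prop :=
  ∃ q : α × ℕ → ℚ, IsComputableRat q ∧ ∀ i k, |(q (i, k) : ℝ) - x i| ≤ (1 / 2 : ℝ) ^ k

/-- A family of complex numbers is computable: its real and imaginary parts are. -/
def IsComputableComplex {α : Type*} [Primcodable α] (z : α → ℂ) : Prop :=
  IsComputableReal (fun i => (z i).re) ∧ IsComputableReal (fun i => (z i).im)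

/-- A computability structure on a complex Banach space, in the axiomatic sense of
Pour-El and Richards: a nonempty set of sequences satisfying the axioms of linear forms,
limits and norms. Sequences are indexed by `ℕ` (from `0`); a double sequence is
computable when its reindexing by the recursive bijection `Nat.unpair : ℕ → ℕ × ℕ` is a
computable sequence. -/
structure ComputabilityStructure (X : Type*) [NormedAddCommGroup X] [NormedSpace ℂ X] where
  /-- the set of computable sequences -/
  seqs : Set (ℕ → X)
  nonempty : seqs.Nonempty
  linear_forms : ∀ x ∈ seqs, ∀ y ∈ seqs, ∀ (a b : ℕ → ℕ → ℂ) (d : ℕ → ℕ),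
    IsComputableComplex (fun p : ℕ × ℕ => a p.1 p.2) →
    IsComputableComplex (fun p : ℕ × ℕ => b p.1 p.2) →
    Computable d →
    (fun n => ∑ k ∈ Finset.range (d n + 1), (a n k • x k + b n k • y k)) ∈ seqs
  limits : ∀ (x : ℕ → ℕ → X) (y : ℕ → X) (e : ℕ → ℕ → ℕ),
    (fun n => x n.unpair.1 n.unpair.2) ∈ seqs →
    Computable (fun p : ℕ × ℕ => e p.1 p.2) →
    (∀ n k, ‖x n (e n k) - y n‖ ≤ (1 / 2 : ℝ) ^ k) →
    y ∈ seqs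
  norms : ∀ x ∈ seqs, IsComputableReal (fun n => ‖x n‖)

/-- A sequence is a generating set (a "basis") if its finite linear combinations are dense. -/
def IsGeneratingSeq {X : Type*} [NormedAddCommGroup X] [NormedSpace ℂ X] (e : ℕ → X) : Prop :=
  Dense (Submodule.span ℂ (Set.range e) : Set X)

namespace ComputabilityStructure

/-- The space is effectively separable: some computable sequence is a generating set. -/
def EffectivelySeparable {X : Type*} [NormedAddCommGroup X] [NormedSpace ℂ X]
    (φ : ComputabilityStructure X) : Prop :=
  ∃ e ∈ φ.seqs, IsGeneratingSeq e

/-- A point is computable if the constant sequence at it is. -/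
def IsComputablePoint {X : Type*} [NormedAddCommGroup X] [NormedSpace ℂ X]
    (φ : ComputabilityStructure X) (x : X) : Prop :=
  (fun _ : ℕ => x) ∈ φ.seqs

/-- A computable orthonormal basis. -/
def IsComputableOrthonormalBasis {X : Type*} [NormedAddCommGroup X] [InnerProductSpace ℂ X]
    (φ : ComputabilityStructure X) (e : ℕ → X) : Prop :=
  e ∈ φ.seqs ∧ Orthonormal ℂ e ∧ IsGeneratingSeq e

end ComputabilityStructure

/-- A lower-computable semi-measure on the set `List Bool` of finite binary strings. -/
def IsLowerComputableSemimeasure (r : List Bool → ℝ) : Prop :=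
  (∀ s, r s ∈ Set.Icc (0 : ℝ) 1) ∧
  (Summable r ∧ ∑' s, r s ≤ 1) ∧
  ∃ f : ℕ → List Bool → ℚ,
    IsComputableRat (fun p : ℕ × List Bool => f p.1 p.2) ∧
    (∀ s, Filter.Tendsto (fun n => (f n s : ℝ)) Filter.atTop (nhds (r s))) ∧
    ∀ n s, 0 ≤ f n s ∧ f n s ≤ f (n + 1) s

/-- A universal probability: a lower-computable semi-measure which dominates, up to a
positive factor, every lower-computable semi-measure. -/
def IsUniversalProbability (m : List Bool → ℝ) : Prop :=
  IsLowerComputableSemimeasure m ∧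
  ∀ r, IsLowerComputableSemimeasure r → ∃ c : ℝ, 0 < c ∧ ∀ s, c * r s ≤ m s

/-- A semi-POVM on the finite binary strings: positive operators whose series converges
strongly to an operator `≤ 1`. The order is the Loewner order. -/
def IsSemiPOVM {X : Type*} [NormedAddCommGroup X] [InnerProductSpace ℂ X]
    (R : List Bool → X →L[ℂ] X) : Prop :=
  (∀ s, (R s).IsPositive) ∧
  ∃ T : X →L[ℂ] X, (∀ x, HasSum (fun s => R s x) (T x)) ∧ T ≤ 1

/-- `T` is an `m`-square rational operator on `e`: its matrix entries `⟨T e_k, e_l⟩` (here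
`inner ℂ (e l) (T (e k))`, Mathlib's inner product being linear in the second variable) vanish
unless both `k` and `l` are among the first `m` indices `0, …, m - 1`, and all lie in
`ℚ + iℚ`. -/
def IsSquareRationalOperator {X : Type*} [NormedAddCommGroup X] [InnerProductSpace ℂ X]
    (e : ℕ → X) (m : ℕ) (T : X →L[ℂ] X) : Prop :=
  (∀ k l, (m ≤ k ∨ m ≤ l) → inner ℂ (e l) (T (e k)) = 0) ∧
  ∀ k l, ∃ a b : ℚ, inner ℂ (e l) (T (e k)) = (a : ℂ) + (b : ℂ) * Complex.I

/-- The semi-POVM `R` is lower-computable with respect to the orthonormal basis `e`. The index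
`n : ℕ` stands for the positive integer `n + 1`. -/
def IsLowerComputableWith {X : Type*} [NormedAddCommGroup X] [InnerProductSpace ℂ X]
    (e : ℕ → X) (R : List Bool → X →L[ℂ] X) : Prop :=
  ∃ (f : ℕ → List Bool → X →L[ℂ] X) (g : ℕ → List Bool → ℕ),
    (∀ n s, (f n s).IsPositive) ∧
    Computable (fun p : ℕ × List Bool => g p.1 p.2) ∧
    (∀ s x, Filter.Tendsto (fun n => f n s x) Filter.atTop (nhds (R s x))) ∧
    (∀ n s, f n s - ((1 / 2 : ℂ) ^ (n + 1)) • (1 : X →L[ℂ] X) ≤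
      f (n + 1) s - ((1 / 2 : ℂ) ^ (n + 2)) • (1 : X →L[ℂ] X)) ∧
    (∀ n s, IsSquareRationalOperator e (g n s) (f n s)) ∧
    IsComputableComplexRat (fun p : ℕ × List Bool × ℕ × ℕ =>
      inner ℂ (e p.2.2.2) (f p.1 p.2.1 (e p.2.2.1)))

/-- A lower-computable semi-POVM. -/
def IsLowerComputableSemiPOVM {X : Type*} [NormedAddCommGroup X] [InnerProductSpace ℂ X]
    (φ : ComputabilityStructure X) (R : List Bool → X →L[ℂ] X) : Prop :=
  IsSemiPOVM R ∧ ∃ e : ℕ → X, φ.IsComputableOrthonormalBasis e ∧ IsLowerComputableWith e R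

/-- A universal semi-POVM: a lower-computable semi-POVM which dominates, up to a positive
factor, every lower-computable semi-POVM. -/
def IsUniversalSemiPOVM {X : Type*} [NormedAddCommGroup X] [InnerProductSpace ℂ X]
    (φ : ComputabilityStructure X) (M : List Bool → X →L[ℂ] X) : Prop :=
  IsLowerComputableSemiPOVM φ M ∧
  ∀ R, IsLowerComputableSemiPOVM φ R → ∃ c : ℝ, 0 < c ∧ ∀ s, (c : ℂ) • R s ≤ M s

/-!
Write `m s = ⟪x, M s x⟫`. Two facts have to be shown.

*`m` is a lower-computable semi-measure* (`IsLowerComputableSemiPOVM.isLowerComputableSemimeasure`).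
Positivity and `∑ m s ≤ 1` follow by evaluating the strongly convergent series of `M` at `x`. For
lower computability, let `f n s` be the finite-rank rational approximants of `M s` on the computable
orthonormal basis `e`. The numbers `⟪x, f n s x⟫ - 2 ^ (-n - 1)` increase to `m s`. They are
computable reals: inner products of computable families of vectors are computable by polarization and the
axiom of norms (`ComputabilityStructure.IsComputableFamily.inner`), and the vectors `f n s x` are
computable by the axiom of linear forms, since their coefficients are the inner products
`⟪f n s (e l), x⟫` and the columns `f n s (e l)` are finite rational combinations of the `e k`
(`isComputableReal_re_inner`). A monotone computable sequence of reals with nonnegative limit is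
finally replaced by a monotone sequence of nonnegative rationals
(`IsComputableReal.exists_monotone_rat`).

*`m` dominates every lower-computable semi-measure `r`.* The operators `r s • 1` form a
lower-computable semi-POVM
(`IsLowerComputableSemimeasure.isLowerComputableSemiPOVM_smul_one`), approximated by rational
multiples of the projections onto the spans of initial segments of `e`. Universality of `M` gives
`c • r s • 1 ≤ M s`, and taking the expectation at the unit vector `x` gives `c * r s ≤ m s`.
-/

/-! ### Arithmetic of computable families of rational numbers -/

namespace IsComputableRat

variable {α β : Type*} [Primcodable α] [Primcodable β]

theorem comp {q : β → ℚ} (hq : IsComputableRat q) {h : α → β} (hh : Computable h) :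
    IsComputableRat (fun i => q (h i)) := by
  obtain ⟨s, a, b, hs, ha, hb, H⟩ := hq
  exact ⟨_, _, _, hs.comp hh, ha.comp hh, hb.comp hh, fun i => H (h i)⟩

/-- A computable family may be given by fractions whose numerator is a difference of natural
numbers; in this form addition and multiplication need no case distinction on signs. -/
theorem of_sub_div {q : α → ℚ} {p m d : α → ℕ} (hp : Computable p) (hm : Computable m)
    (hd : Computable d) (H : ∀ i, d i ≠ 0 ∧ q i = ((p i : ℚ) - m i) / d i) :
    IsComputableRat q := by
  refine ⟨fun i => 1 - (p i + 1 - m i), fun i => (p i - m i) + (m i - p i), d, ?_, ?_, hd,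
    fun i => ⟨(H i).1, ?_⟩⟩
  · exact Primrec.nat_sub.to_comp.comp (Computable.const 1)
      (Primrec.nat_sub.to_comp.comp (Computable.succ.comp hp) hm)
  · exact Primrec.nat_add.to_comp.comp (Primrec.nat_sub.to_comp.comp hp hm)
      (Primrec.nat_sub.to_comp.comp hm hp)
  · rw [(H i).2]
    congr 1
    rcases le_or_gt (m i) (p i) with h | h
    · have h1 : 1 - (p i + 1 - m i) = 0 := by omega
      have h2 : m i - p i = 0 := by omega
      simp only [h1, h2, pow_zero, one_mul, add_zero]
      rw [Nat.cast_sub h]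
    · have h1 : 1 - (p i + 1 - m i) = 1 := by omega
      have h2 : p i - m i = 0 := by omega
      simp only [h1, h2, pow_one, zero_add]
      rw [Nat.cast_sub h.le]
      ring

theorem exists_sub_div {q : α → ℚ} (hq : IsComputableRat q) :
    ∃ p m d : α → ℕ, Computable p ∧ Computable m ∧ Computable d ∧
      ∀ i, d i ≠ 0 ∧ (p i = 0 ∨ m i = 0) ∧ q i = ((p i : ℚ) - m i) / d i := by
  obtain ⟨s, a, b, hs, ha, hb, H⟩ := hq
  have hbodd : Computable fun i => (s i).bodd := Computable.nat_bodd.comp hs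
  refine ⟨fun i => bif (s i).bodd then 0 else a i, fun i => bif (s i).bodd then a i else 0, b,
    Computable.cond hbodd (Computable.const 0) ha, Computable.cond hbodd ha (Computable.const 0),
    hb, fun i => ⟨(H i).1, ?_, ?_⟩⟩
  · cases h : (s i).bodd <;> simp [h]
  · rw [(H i).2]
    congr 1
    cases h : (s i).bodd
    · have : Even (s i) := by
        rw [Nat.even_iff, Nat.mod_two_of_bodd, h]; rfl
      simp [this.neg_one_pow, h]
    · have : Odd (s i) := by
        rw [Nat.odd_iff, Nat.mod_two_of_bodd, h]; rfl
      simp [this.neg_one_pow, h]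

theorem const (c : ℚ) : IsComputableRat (fun _ : α => c) :=
  of_sub_div (p := fun _ => c.num.toNat) (m := fun _ => (-c.num).toNat) (d := fun _ => c.den)
    (Computable.const _) (Computable.const _) (Computable.const _) fun _ => by
      refine ⟨c.den_nz, ?_⟩
      have h : ((c.num.toNat : ℤ) - ((-c.num).toNat : ℤ)) = c.num := by omega
      have h' : ((c.num.toNat : ℚ) - ((-c.num).toNat : ℚ)) = c.num := by exact_mod_cast h
      rw [h', Rat.num_div_den]

theorem add {q r : α → ℚ} (hq : IsComputableRat q) (hr : IsComputableRat r) :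
    IsComputableRat (fun i => q i + r i) := by
  obtain ⟨p, m, d, hp, hm, hd, H⟩ := hq.exists_sub_div
  obtain ⟨p', m', d', hp', hm', hd', H'⟩ := hr.exists_sub_div
  have A := Primrec.nat_add.to_comp
  have M := Primrec.nat_mul.to_comp
  refine of_sub_div (A.comp (M.comp hp hd') (M.comp hp' hd))
    (A.comp (M.comp hm hd') (M.comp hm' hd)) (M.comp hd hd') fun i => ?_
  obtain ⟨h1, -, h2⟩ := H i
  obtain ⟨h1', -, h2'⟩ := H' i
  refine ⟨mul_ne_zero h1 h1', ?_⟩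
  have : (d i : ℚ) ≠ 0 := Nat.cast_ne_zero.2 h1
  have : (d' i : ℚ) ≠ 0 := Nat.cast_ne_zero.2 h1'
  rw [h2, h2']
  push_cast
  field_simp
  ring

theorem mul {q r : α → ℚ} (hq : IsComputableRat q) (hr : IsComputableRat r) :
    IsComputableRat (fun i => q i * r i) := by
  obtain ⟨p, m, d, hp, hm, hd, H⟩ := hq.exists_sub_div
  obtain ⟨p', m', d', hp', hm', hd', H'⟩ := hr.exists_sub_div
  have A := Primrec.nat_add.to_comp
  have M := Primrec.nat_mul.to_comp
  refine of_sub_div (A.comp (M.comp hp hp') (M.comp hm hm'))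
    (A.comp (M.comp hp hm') (M.comp hm hp')) (M.comp hd hd') fun i => ?_
  obtain ⟨h1, -, h2⟩ := H i
  obtain ⟨h1', -, h2'⟩ := H' i
  refine ⟨mul_ne_zero h1 h1', ?_⟩
  have : (d i : ℚ) ≠ 0 := Nat.cast_ne_zero.2 h1
  have : (d' i : ℚ) ≠ 0 := Nat.cast_ne_zero.2 h1'
  rw [h2, h2']
  push_cast
  field_simp
  ring

theorem sub {q r : α → ℚ} (hq : IsComputableRat q) (hr : IsComputableRat r) :
    IsComputableRat (fun i => q i - r i) := by
  simpa [sub_eq_add_neg] using hq.add ((const (-1)).mul hr)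

theorem max_zero {q : α → ℚ} (hq : IsComputableRat q) : IsComputableRat (fun i => max (q i) 0) := by
  obtain ⟨p, m, d, hp, -, hd, H⟩ := hq.exists_sub_div
  refine of_sub_div hp (Computable.const 0) hd fun i => ?_
  obtain ⟨h1, h, h2⟩ := H i
  refine ⟨h1, ?_⟩
  rw [h2]
  rcases h with h | h
  · simp only [h, Nat.cast_zero, sub_zero, zero_div, zero_sub]
    exact max_eq_right (div_nonpos_of_nonpos_of_nonneg (by simp) (by positivity))
  · simp only [h, Nat.cast_zero, sub_zero]
    exact max_eq_left (by positivity)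

theorem cond {c : α → Bool} {q r : α → ℚ} (hc : Computable c) (hq : IsComputableRat q)
    (hr : IsComputableRat r) : IsComputableRat (fun i => bif c i then q i else r i) := by
  obtain ⟨s, a, b, hs, ha, hb, H⟩ := hq
  obtain ⟨s', a', b', hs', ha', hb', H'⟩ := hr
  refine ⟨_, _, _, .cond hc hs hs', .cond hc ha ha', .cond hc hb hb', fun i => ?_⟩
  cases h : c i
  · simpa [h] using H' i
  · simpa [h] using H i

theorem half_pow {n : α → ℕ} (hn : Computable n) :
    IsComputableRat (fun i => (1 / 2 : ℚ) ^ n i) := by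
  have hpow : Primrec₂ ((· ^ ·) : ℕ → ℕ → ℕ) := Primrec₂.unpaired'.1 Nat.Primrec.pow
  exact of_sub_div (Computable.const 1) (Computable.const 0)
    (hpow.to_comp.comp (Computable.const 2) hn) fun i => ⟨by positivity, by simp⟩

/-- A computable family of rationals has a computable family of natural upper bounds. -/
theorem exists_abs_le {q : α → ℚ} (hq : IsComputableRat q) :
    ∃ N : α → ℕ, Computable N ∧ ∀ i, |q i| ≤ N i := by
  obtain ⟨s, a, b, -, ha, -, H⟩ := hq
  refine ⟨a, ha, fun i => ?_⟩
  rw [(H i).2, abs_div, abs_mul, abs_neg_one_pow, one_mul, Nat.abs_cast, Nat.abs_cast]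
  exact div_le_self (by positivity) (Nat.one_le_cast.2 (Nat.one_le_iff_ne_zero.2 (H i).1))

end IsComputableRat

/-! ### Computable families of real and complex numbers -/

namespace IsComputableReal

variable {α β : Type*} [Primcodable α] [Primcodable β]

theorem comp {x : β → ℝ} (hx : IsComputableReal x) {h : α → β} (hh : Computable h) :
    IsComputableReal (fun i => x (h i)) := by
  obtain ⟨q, hq, H⟩ := hx
  exact ⟨fun p => q (h p.1, p.2),
    hq.comp ((hh.comp Computable.fst).pair Computable.snd), fun i k => H (h i) k⟩

theorem of_rat {q : α → ℚ} (hq : IsComputableRat q) : IsComputableReal (fun i => (q i : ℝ)) :=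
  ⟨fun p => q p.1, hq.comp Computable.fst, fun i k => by simp⟩

theorem add {x y : α → ℝ} (hx : IsComputableReal x) (hy : IsComputableReal y) :
    IsComputableReal (fun i => x i + y i) := by
  obtain ⟨q, hq, H⟩ := hx
  obtain ⟨r, hr, H'⟩ := hy
  have hs : Computable fun p : α × ℕ => (p.1, p.2 + 1) :=
    Computable.fst.pair (Computable.succ.comp Computable.snd)
  refine ⟨fun p => q (p.1, p.2 + 1) + r (p.1, p.2 + 1), (hq.comp hs).add (hr.comp hs),
    fun i k => ?_⟩
  have h1 := H i (k + 1)
  have h2 := H' i (k + 1)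
  rw [pow_succ] at h1 h2
  rw [abs_le] at h1 h2 ⊢
  push_cast
  constructor <;> linarith

/-- Multiplication by a rational constant; the constant `2 ^ N` bounding it is absorbed by raising
the precision. -/
theorem const_mul (c : ℚ) {x : α → ℝ} (hx : IsComputableReal x) :
    IsComputableReal (fun i => (c : ℝ) * x i) := by
  obtain ⟨q, hq, H⟩ := hx
  obtain ⟨N, hN⟩ := pow_unbounded_of_one_lt |(c : ℝ)| (one_lt_two : (1 : ℝ) < 2)
  have hs : Computable fun p : α × ℕ => (p.1, p.2 + N) :=
    Computable.fst.pair (Primrec.nat_add.to_comp.comp Computable.snd (Computable.const N))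
  refine ⟨fun p => c * q (p.1, p.2 + N), (IsComputableRat.const c).mul (hq.comp hs),
    fun i k => ?_⟩
  push_cast
  rw [← mul_sub, abs_mul]
  calc |(c : ℝ)| * |(q (i, k + N) : ℝ) - x i| ≤ 2 ^ N * (1 / 2) ^ (k + N) :=
        mul_le_mul hN.le (H i _) (abs_nonneg _) (by positivity)
    _ = (1 / 2 : ℝ) ^ k := by
        rw [pow_add, mul_left_comm, ← mul_pow]; norm_num

theorem sub {x y : α → ℝ} (hx : IsComputableReal x) (hy : IsComputableReal y) :
    IsComputableReal (fun i => x i - y i) := by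
  simpa [sub_eq_add_neg] using hx.add (hy.const_mul (-1))

theorem sq {x : α → ℝ} (hx : IsComputableReal x) : IsComputableReal (fun i => x i ^ 2) := by
  obtain ⟨q, hq, H⟩ := hx
  obtain ⟨N, hN, hqN⟩ :=
    (hq.comp (Computable.id.pair (Computable.const 0)) :
      IsComputableRat fun i : α => q (i, 0)).exists_abs_le
  -- `|q| + |x| ≤ 2 (N + 1) + 1 ≤ 2 ^ (2 N + 3)` bounds the loss of precision under squaring
  let e : α × ℕ → ℕ := fun p => p.2 + (2 * N p.1 + 3)
  have he : Computable e := by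
    have A := Primrec.nat_add.to_comp
    have M := Primrec.nat_mul.to_comp
    exact A.comp Computable.snd (A.comp (M.comp (Computable.const 2) (hN.comp Computable.fst))
      (Computable.const 3))
  have hs : IsComputableRat fun p : α × ℕ => q (p.1, e p) := hq.comp (Computable.fst.pair he)
  refine ⟨fun p => q (p.1, e p) * q (p.1, e p), hs.mul hs, fun i k => ?_⟩
  have h0 := H i 0
  have h1 := H i (e (i, k))
  have hN' : |(q (i, 0) : ℝ)| ≤ N i := by exact_mod_cast hqN i
  have hle : (1 / 2 : ℝ) ^ e (i, k) ≤ 1 := pow_le_one₀ (by norm_num) (by norm_num)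
  have hx : |x i| ≤ N i + 1 := by
    rw [abs_le] at *
    constructor <;> linarith
  have hsum : |(q (i, e (i, k)) : ℝ) + x i| ≤ 2 ^ (2 * N i + 3) := by
    have h2 : ((2 * N i + 3 : ℕ) : ℝ) ≤ 2 ^ (2 * N i + 3) := by
      exact_mod_cast Nat.lt_two_pow_self.le
    push_cast at h2
    rw [abs_le] at *
    constructor <;> linarith
  push_cast
  calc |(q (i, e (i, k)) : ℝ) * q (i, e (i, k)) - x i ^ 2|
      = |(q (i, e (i, k)) : ℝ) + x i| * |(q (i, e (i, k)) : ℝ) - x i| := by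
        rw [← abs_mul]; ring_nf
    _ ≤ 2 ^ (2 * N i + 3) * (1 / 2) ^ e (i, k) :=
        mul_le_mul hsum h1 (abs_nonneg _) (by positivity)
    _ = (1 / 2 : ℝ) ^ k := by
        simp only [e]
        rw [pow_add _ k, mul_left_comm, ← mul_pow]; norm_num

/-- A computable nondecreasing sequence of reals with nonnegative limit can be replaced by a
computable nondecreasing sequence of nonnegative rationals with the same limit. -/
theorem exists_monotone_rat {a : ℕ × β → ℝ} (ha : IsComputableReal a) {m : β → ℝ}
    (hm : ∀ s, 0 ≤ m s) (hmono : ∀ n s, a (n, s) ≤ a (n + 1, s))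
    (hlim : ∀ s, Filter.Tendsto (fun n => a (n, s)) Filter.atTop (nhds (m s))) :
    ∃ f : ℕ → β → ℚ, IsComputableRat (fun p : ℕ × β => f p.1 p.2) ∧
      (∀ s, Filter.Tendsto (fun n => (f n s : ℝ)) Filter.atTop (nhds (m s))) ∧
      ∀ n s, 0 ≤ f n s ∧ f n s ≤ f (n + 1) s := by
  obtain ⟨q, hq, H⟩ := ha
  -- Subtracting `2 ^ (-n)` makes the sequence increase by at least `2 ^ (-n - 1)` at each step,
  -- so that approximations with error `2 ^ (-n - 3)` still increase.
  let t : ℕ → β → ℚ := fun n s => q ((n, s), n + 3) - (1 / 2) ^ n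
  have ht : IsComputableRat fun p : ℕ × β => t p.1 p.2 :=
    (hq.comp (Computable.id.pair (Primrec.nat_add.to_comp.comp Computable.fst
      (Computable.const 3)))).sub (IsComputableRat.half_pow Computable.fst)
  refine ⟨fun n s => max (t n s) 0, ht.max_zero, fun s => ?_, fun n s => ⟨le_max_right _ _, ?_⟩⟩
  · have hp : Filter.Tendsto (fun n : ℕ => (1 / 2 : ℝ) ^ n) Filter.atTop (nhds 0) :=
      tendsto_pow_atTop_nhds_zero_of_lt_one (by norm_num) (by norm_num)
    have hd : Filter.Tendsto (fun n => (q ((n, s), n + 3) : ℝ) - a (n, s)) Filter.atTop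
        (nhds 0) :=
      squeeze_zero_norm (fun n => (H (n, s) (n + 3)).trans
        (pow_le_pow_of_le_one (by norm_num) (by norm_num) (Nat.le_add_right n 3))) hp
    have h1 := ((hd.add (hlim s)).sub hp).max (tendsto_const_nhds (x := (0 : ℝ)))
    simp only [zero_add, sub_zero, max_eq_left (hm s)] at h1
    refine h1.congr fun n => ?_
    simp [t]
  · refine max_le_max ?_ le_rfl
    have h1 := H (n, s) (n + 3)
    have h2 := H (n + 1, s) (n + 1 + 3)
    have h3 := hmono n s
    have h4 : (0 : ℝ) < (1 / 2) ^ n := by positivity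
    have : (t n s : ℝ) ≤ t (n + 1) s := by
      simp only [t]
      push_cast
      simp only [pow_succ] at h1 h2 ⊢
      rw [abs_le] at h1 h2
      linarith
    exact_mod_cast this

end IsComputableReal

theorem IsComputableComplex.comp {α β : Type*} [Primcodable α] [Primcodable β] {z : β → ℂ}
    (hz : IsComputableComplex z) {h : α → β} (hh : Computable h) :
    IsComputableComplex (fun i => z (h i)) :=
  ⟨hz.1.comp hh, hz.2.comp hh⟩

theorem IsComputableComplexRat.isComputableComplex {α : Type*} [Primcodable α] {z : α → ℂ}
    (hz : IsComputableComplexRat z) : IsComputableComplex z := by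
  obtain ⟨p, q, hp, hq, H⟩ := hz
  constructor
  · simpa [H] using IsComputableReal.of_rat hp
  · simpa [H] using IsComputableReal.of_rat hq

/-- The coefficients that select the term `k = h i`, with a factor `u + v i`. -/
theorem isComputableComplex_single {α : Type*} [Primcodable α] {h : α → ℕ} (hh : Computable h)
    (u v : ℚ) :
    IsComputableComplex (fun p : α × ℕ => if p.2 = h p.1 then (u : ℂ) + v * Complex.I else 0) := by
  have hc : Computable fun p : α × ℕ => decide (p.2 = h p.1) := by
    have := (Primrec.beq (α := ℕ)).to_comp.comp (Computable.snd (α := α)) (hh.comp Computable.fst)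
    exact this.of_eq fun p => by simp [beq_eq_decide]
  refine IsComputableComplexRat.isComputableComplex ⟨_, _,
    IsComputableRat.cond hc (.const u) (.const 0), IsComputableRat.cond hc (.const v) (.const 0),
    fun p => ?_⟩
  by_cases hp : p.2 = h p.1 <;> simp [hp]

/-! ### Computable families of vectors -/

namespace ComputabilityStructure

section Banach

variable {X : Type*} [NormedAddCommGroup X] [NormedSpace ℂ X] {φ : ComputabilityStructure X}
  {α : Type*} [Primcodable α] [Inhabited α]

/-- A family of vectors indexed by an encodable type is computable: the sequence of its values at
the decoded natural numbers is computable, numbers that encode no index being sent to the default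
one. -/
def IsComputableFamily (φ : ComputabilityStructure X) (u : α → X) : Prop :=
  (fun n : ℕ => u ((Encodable.decode n).getD default)) ∈ φ.seqs

theorem computable_decode_getD :
    Computable fun n : ℕ => (Encodable.decode (α := α) n).getD default :=
  Computable.option_getD Computable.decode (Computable.const default)

/-- The axiom of linear forms, for the finite sums `∑ k ≤ d a, c a k • e k`. -/
theorem isComputableFamily_sum {e : ℕ → X} (he : e ∈ φ.seqs) {c : α → ℕ → ℂ} {d : α → ℕ}
    (hc : IsComputableComplex fun p : α × ℕ => c p.1 p.2) (hd : Computable d) :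
    φ.IsComputableFamily fun a => ∑ k ∈ Finset.range (d a + 1), c a k • e k := by
  have h0 : IsComputableComplex fun _ : ℕ × ℕ => (0 : ℂ) := by
    constructor <;> simpa using IsComputableReal.of_rat (IsComputableRat.const 0)
  have := φ.linear_forms e he e he
    (fun n k => c ((Encodable.decode n).getD default) k) (fun _ _ => 0)
    (fun n => d ((Encodable.decode n).getD default))
    (hc.comp ((computable_decode_getD.comp Computable.fst).pair Computable.snd)) h0
    (hd.comp computable_decode_getD)
  simpa [IsComputableFamily] using this

namespace IsComputableFamily

/-- Gaussian rational scalars suffice here, since they include the `1, -1, -i` of polarization. -/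
theorem add_smul {u v : α → X} (hu : φ.IsComputableFamily u) (hv : φ.IsComputableFamily v)
    (a b : ℚ) : φ.IsComputableFamily fun i => u i + ((a : ℂ) + b * Complex.I) • v i := by
  have := φ.linear_forms _ hu _ hv
    (fun n k => if k = id n then ((1 : ℚ) : ℂ) + (0 : ℚ) * Complex.I else 0)
    (fun n k => if k = id n then (a : ℂ) + b * Complex.I else 0) id
    (isComputableComplex_single (h := id) Computable.id 1 0)
    (isComputableComplex_single (h := id) Computable.id a b) Computable.id
  simpa [IsComputableFamily, ite_smul, Finset.sum_add_distrib] using this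

theorem norm {u : α → X} (hu : φ.IsComputableFamily u) :
    IsComputableReal fun i => ‖u i‖ := by
  simpa using (φ.norms _ hu).comp (h := (Encodable.encode : α → ℕ)) Computable.encode

end IsComputableFamily

end Banach

namespace IsComputableFamily

variable {X : Type*} [NormedAddCommGroup X] [InnerProductSpace ℂ X] {φ : ComputabilityStructure X}
  {α : Type*} [Primcodable α] [Inhabited α]

theorem re_inner {u v : α → X} (hu : φ.IsComputableFamily u) (hv : φ.IsComputableFamily v) :
    IsComputableReal fun i => (inner ℂ (u i) (v i)).re := by
  have h1 := (hu.add_smul hv 1 0).norm.sq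
  have h2 := (hu.add_smul hv (-1) 0).norm.sq
  have h := (h1.sub h2).const_mul (1 / 4)
  convert h using 2 with i
  have := re_inner_eq_norm_add_mul_self_sub_norm_sub_mul_self_div_four (𝕜 := ℂ) (u i) (v i)
  rw [RCLike.re_to_complex] at this
  rw [this]
  simp [← sub_eq_add_neg]
  ring

/-- The inner product is computable: by polarization it is a combination of squares of norms. -/
theorem inner {u v : α → X} (hu : φ.IsComputableFamily u) (hv : φ.IsComputableFamily v) :
    IsComputableComplex fun i => inner ℂ (u i) (v i) := by
  refine ⟨hu.re_inner hv, ?_⟩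
  -- `Im ⟪u, v⟫ = Re ⟪u, u - i v⟫ - Re ⟪u, u⟫`
  convert (hu.re_inner (hu.add_smul hv 0 (-1))).sub (hu.re_inner hu) using 2 with i
  simp [inner_smul_right]

end IsComputableFamily

end ComputabilityStructure

/-! ### Matrices with respect to a generating orthonormal sequence -/

section Orthonormal

variable {X : Type*} [NormedAddCommGroup X] [InnerProductSpace ℂ X] {e : ℕ → X}

theorem IsGeneratingSeq.ext_inner (hg : IsGeneratingSeq e) {u v : X}
    (h : ∀ k, inner ℂ (e k) u = inner ℂ (e k) v) : u = v := by
  refine Dense.eq_of_inner_right ℂ hg fun w hw => ?_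
  induction hw using Submodule.span_induction with
  | mem w hw => obtain ⟨k, rfl⟩ := hw; exact h k
  | zero => simp
  | add a b _ _ ha hb => rw [inner_add_left, inner_add_left, ha, hb]
  | smul c a _ ha => rw [inner_smul_left, inner_smul_left, ha]

/-- A vector with only finitely many nonzero coefficients is the finite sum of its expansion. The
sum has one more term than needed, to fit the axiom of linear forms. -/
theorem IsGeneratingSeq.eq_sum (hg : IsGeneratingSeq e) (ho : Orthonormal ℂ e) {u : X} {m : ℕ}
    (h : ∀ k, m ≤ k → inner ℂ (e k) u = 0) :
    u = ∑ k ∈ Finset.range (m + 1), inner ℂ (e k) u • e k := by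
  refine hg.ext_inner fun k => ?_
  rw [inner_sum]
  simp only [inner_smul_right, orthonormal_iff_ite.1 ho]
  simp only [mul_ite, mul_one, mul_zero, Finset.sum_ite_eq, Finset.mem_range]
  split_ifs with hk
  · rfl
  · exact h k (by omega)

/-- The orthogonal projection onto the span of `e 0, …, e (n - 1)`, as a sum of projections of
rank one. -/
noncomputable def initialProjection (e : ℕ → X) (n : ℕ) : X →L[ℂ] X :=
  ∑ i ∈ Finset.range n, InnerProductSpace.rankOne ℂ (e i) (e i)

theorem initialProjection_isPositive (e : ℕ → X) (n : ℕ) : (initialProjection e n).IsPositive :=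
  ContinuousLinearMap.isPositive_sum _ fun _ _ => InnerProductSpace.isPositive_rankOne_self _

theorem inner_initialProjection (ho : Orthonormal ℂ e) (n k l : ℕ) :
    inner ℂ (e l) (initialProjection e n (e k)) = if k = l ∧ k < n then 1 else 0 := by
  simp only [initialProjection, sum_apply, InnerProductSpace.rankOne_apply,
    inner_sum, inner_smul_right, orthonormal_iff_ite.1 ho]
  by_cases hkl : k = l
  · subst hkl; simp
  · simp [hkl, Ne.symm hkl]

theorem tendsto_initialProjection [CompleteSpace X] (ho : Orthonormal ℂ e)
    (hg : IsGeneratingSeq e) (y : X) :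
    Filter.Tendsto (fun n => initialProjection e n y) Filter.atTop (nhds y) := by
  let b := HilbertBasis.mk ho (by
    rw [Submodule.dense_iff_topologicalClosure_eq_top.1 hg])
  have h := (b.hasSum_repr y).tendsto_sum_nat
  refine h.congr fun n => ?_
  simp [initialProjection, b.repr_apply_apply, b]

end Orthonormal

/-! ### The probability of a computable state is a lower-computable semi-measure -/

section State

variable {X : Type*} [NormedAddCommGroup X] [InnerProductSpace ℂ X]

theorem ContinuousLinearMap.IsPositive.ofReal_re_inner {T : X →L[ℂ] X} (hT : T.IsPositive)
    (x : X) : ((inner ℂ x (T x)).re : ℂ) = inner ℂ x (T x) := by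
  have := hT.inner_nonneg_right x
  exact Complex.ext rfl (Complex.nonneg_iff.1 this).2

theorem re_inner_le_of_le {S T : X →L[ℂ] X} (h : S ≤ T) (x : X) :
    (inner ℂ x (S x)).re ≤ (inner ℂ x (T x)).re := by
  have := ((ContinuousLinearMap.le_def _ _).1 h).re_inner_nonneg_right x
  simpa [inner_sub_right] using this

/-- A computable double sequence of finite-rank operators with rational matrices has computable
expectations at a computable point `x`. No matrix sums are needed: the vectors `f n s (e l)`, their
inner products with `x`, the vectors `f n s x` and their inner products with `x` are computable in
turn. -/
theorem isComputableReal_re_inner {φ : ComputabilityStructure X} {e : ℕ → X}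
    (he : φ.IsComputableOrthonormalBasis e) {x : X} (hx : φ.IsComputablePoint x)
    {f : ℕ → List Bool → X →L[ℂ] X} {g : ℕ → List Bool → ℕ}
    (hpos : ∀ n s, (f n s).IsPositive) (hg : Computable fun p : ℕ × List Bool => g p.1 p.2)
    (hsq : ∀ n s, IsSquareRationalOperator e (g n s) (f n s))
    (hf : IsComputableComplexRat fun p : ℕ × List Bool × ℕ × ℕ =>
      inner ℂ (e p.2.2.2) (f p.1 p.2.1 (e p.2.2.1))) :
    IsComputableReal fun p : ℕ × List Bool => (inner ℂ x (f p.1 p.2 x)).re := by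
  obtain ⟨hes, ho, hgen⟩ := he
  have hcol : φ.IsComputableFamily fun a : ℕ × List Bool × ℕ => f a.1 a.2.1 (e a.2.2) := by
    have hc : IsComputableComplex fun p : (ℕ × List Bool × ℕ) × ℕ =>
        inner ℂ (e p.2) (f p.1.1 p.1.2.1 (e p.1.2.2)) :=
      hf.isComputableComplex.comp
        (h := fun p : (ℕ × List Bool × ℕ) × ℕ => (p.1.1, p.1.2.1, p.1.2.2, p.2))
        ((Computable.fst.comp .fst).pair ((Computable.fst.comp (Computable.snd.comp .fst)).pair
          ((Computable.snd.comp (Computable.snd.comp .fst)).pair .snd)))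
    have hd : Computable fun a : ℕ × List Bool × ℕ => g a.1 a.2.1 :=
      hg.comp (Computable.fst.pair (Computable.fst.comp .snd))
    convert ComputabilityStructure.isComputableFamily_sum hes
      (c := fun (a : ℕ × List Bool × ℕ) k => inner ℂ (e k) (f a.1 a.2.1 (e a.2.2)))
      hc hd using 2 with a
    exact hgen.eq_sum ho fun k hk => (hsq _ _).1 _ _ (Or.inr hk)
  have hcoef : IsComputableComplex fun a : ℕ × List Bool × ℕ =>
      inner ℂ (f a.1 a.2.1 (e a.2.2)) x :=
    hcol.inner (v := fun _ => x) hx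
  have hvec : φ.IsComputableFamily fun p : ℕ × List Bool => f p.1 p.2 x := by
    have hc : IsComputableComplex fun p : (ℕ × List Bool) × ℕ =>
        inner ℂ (f p.1.1 p.1.2 (e p.2)) x :=
      hcoef.comp (h := fun p : (ℕ × List Bool) × ℕ => (p.1.1, p.1.2, p.2))
        ((Computable.fst.comp .fst).pair ((Computable.snd.comp .fst).pair .snd))
    convert ComputabilityStructure.isComputableFamily_sum hes
      (c := fun (p : ℕ × List Bool) k => inner ℂ (f p.1 p.2 (e k)) x) hc hg using 2 with p
    simp only [(hpos _ _).inner_left_eq_inner_right]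
    refine hgen.eq_sum ho fun k hk => ?_
    have hzero : f p.1 p.2 (e k) = 0 := hgen.ext_inner fun l => by
      rw [(hsq _ _).1 _ _ (Or.inl hk), inner_zero_right]
    rw [← (hpos _ _).inner_left_eq_inner_right, hzero, inner_zero_left]
  exact ComputabilityStructure.IsComputableFamily.re_inner (u := fun _ => x) hx hvec

theorem IsLowerComputableSemiPOVM.isLowerComputableSemimeasure {φ : ComputabilityStructure X}
    {R : List Bool → X →L[ℂ] X} (hR : IsLowerComputableSemiPOVM φ R) {x : X}
    (hx : φ.IsComputablePoint x) (hx1 : ‖x‖ = 1) :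
    IsLowerComputableSemimeasure fun s => (inner ℂ x (R s x)).re := by
  obtain ⟨⟨hpos, T, hT, hT1⟩, e, he, f, g, hfpos, hg, hlim, hmono, hsq, hf⟩ := hR
  have hxx : inner ℂ x x = (1 : ℂ) := by
    rw [inner_self_eq_norm_sq_to_K, hx1]; simp
  have h0 : ∀ s, 0 ≤ (inner ℂ x (R s x)).re := fun s => (hpos s).re_inner_nonneg_right x
  have hsum : HasSum (fun s => (inner ℂ x (R s x)).re) (inner ℂ x (T x)).re :=
    Complex.hasSum_re (by simpa using (hT x).mapL (innerSL ℂ x))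
  have hle : (inner ℂ x (T x)).re ≤ 1 := by
    simpa [hx1] using re_inner_le_of_le hT1 x
  refine ⟨fun s => ⟨h0 s, (le_hasSum hsum s fun t _ => h0 t).trans hle⟩,
    ⟨hsum.summable, hsum.tsum_eq.le.trans hle⟩, ?_⟩
  -- the monotone quantity is the expectation of `f n s - 2 ^ (-n - 1)`
  have ha : IsComputableReal fun p : ℕ × List Bool =>
      (inner ℂ x (f p.1 p.2 x)).re - ((((1 / 2) ^ (p.1 + 1) : ℚ)) : ℝ) :=
    (isComputableReal_re_inner he hx hfpos hg hsq hf).sub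
      (.of_rat (.half_pow (Computable.succ.comp Computable.fst)))
  have hscal : ∀ (S : X →L[ℂ] X) (n : ℕ),
      (inner ℂ x ((S - ((1 / 2 : ℂ) ^ n) • (1 : X →L[ℂ] X)) x)).re
        = (inner ℂ x (S x)).re - (1 / 2 : ℝ) ^ n := fun S n => by
    have : ((1 / 2 : ℂ) ^ n) = (((1 / 2 : ℝ) ^ n : ℝ) : ℂ) := by push_cast; rfl
    rw [this]
    simp only [sub_apply, smul_apply,
      one_apply_eq_self, inner_sub_right, inner_smul_right, hxx, mul_one,
      Complex.sub_re, Complex.ofReal_re]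
  refine ha.exists_monotone_rat h0 (fun n s => ?_) fun s => ?_
  · have := re_inner_le_of_le (hmono n s) x
    rw [hscal, hscal] at this
    push_cast
    exact this
  · have h1 : Filter.Tendsto (fun n => (inner ℂ x (f n s x)).re) Filter.atTop
        (nhds (inner ℂ x (R s x)).re) :=
      (Complex.continuous_re.tendsto _).comp (tendsto_const_nhds.inner (hlim s x))
    have h2 : Filter.Tendsto (fun n : ℕ => (1 / 2 : ℝ) ^ (n + 1)) Filter.atTop (nhds 0) :=
      (tendsto_pow_atTop_nhds_zero_of_lt_one (by norm_num) (by norm_num)).comp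
        (Filter.tendsto_add_atTop_nat 1)
    simpa using h1.sub h2

end State

/-! ### Multiples of the identity as semi-POVMs -/

section Scalar

variable {X : Type*} [NormedAddCommGroup X] [InnerProductSpace ℂ X] [CompleteSpace X]

/-- The approximants of `r s • 1` are `h n s` times the projection onto the first `n` basis
vectors, where `h` approximates `r`: these even increase with `n`. -/
theorem IsLowerComputableSemimeasure.isLowerComputableSemiPOVM_smul_one
    {φ : ComputabilityStructure X} {e : ℕ → X} (he : φ.IsComputableOrthonormalBasis e)
    {r : List Bool → ℝ} (hr : IsLowerComputableSemimeasure r) :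
    IsLowerComputableSemiPOVM φ fun s => (r s : ℂ) • (1 : X →L[ℂ] X) := by
  obtain ⟨hr01, ⟨hsum, hle⟩, h, hh, hlim, hmono⟩ := hr
  have hone : (1 : X →L[ℂ] X).IsPositive := ContinuousLinearMap.isPositive_one
  have hsmul : ∀ {T : X →L[ℂ] X} {c : ℝ}, T.IsPositive → 0 ≤ c → ((c : ℂ) • T).IsPositive :=
    fun hT hc => hT.smul_of_nonneg (Complex.zero_le_real.2 hc)
  refine ⟨⟨fun s => hsmul hone (hr01 s).1, ((∑' s, r s : ℝ) : ℂ) • 1, fun y => ?_, ?_⟩, e, he,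
    fun n s => ((h n s : ℝ) : ℂ) • initialProjection e n, fun n _ => n, fun n s => ?_,
    Computable.fst, fun s y => ?_, fun n s => ?_, fun n s => ⟨fun k l hkl => ?_, fun k l => ?_⟩, ?_⟩
  · simpa using (Complex.hasSum_ofReal.2 hsum.hasSum).smul_const y
  · rw [ContinuousLinearMap.le_def]
    convert hsmul hone (sub_nonneg.2 hle) using 1
    push_cast
    rw [sub_smul, one_smul]
  · exact hsmul (initialProjection_isPositive e n) (by exact_mod_cast (hmono n s).1)
  · exact ((Complex.continuous_ofReal.tendsto _).comp (hlim s)).smul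
      (tendsto_initialProjection he.2.1 he.2.2 y)
  · rw [ContinuousLinearMap.le_def]
    have h1 := hsmul (initialProjection_isPositive e (n + 1)) (c := h (n + 1) s - h n s)
      (by exact_mod_cast sub_nonneg.2 (hmono n s).2)
    have h2 := hsmul (InnerProductSpace.isPositive_rankOne_self (𝕜 := ℂ) (e n)) (c := h n s)
      (by exact_mod_cast (hmono n s).1)
    have h3 := hsmul hone (c := (1 / 2) ^ (n + 2)) (by positivity)
    convert (h1.add h2).add h3 using 1
    simp only [initialProjection, Finset.sum_range_succ]
    push_cast
    rw [pow_succ _ (n + 1)]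
    module
  · rw [smul_apply, inner_smul_right, inner_initialProjection he.2.1,
      if_neg (by dsimp only at hkl; omega), mul_zero]
  · refine ⟨if k = l ∧ k < n then h n s else 0, 0, ?_⟩
    rw [smul_apply, inner_smul_right, inner_initialProjection he.2.1]
    split_ifs <;> simp
  · have hkl : Computable fun p : ℕ × List Bool × ℕ × ℕ => decide (p.2.2.1 = p.2.2.2) := by
      refine ((Primrec.beq (α := ℕ)).to_comp.comp
        (Computable.fst.comp (Computable.snd.comp .snd))
        (Computable.snd.comp (Computable.snd.comp .snd))).of_eq fun p => ?_
      simp [beq_eq_decide]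
    have hkn : Computable fun p : ℕ × List Bool × ℕ × ℕ => decide (p.2.2.1 < p.1) := by
      have := (Primrec.nat_lt.decide).to_comp.comp
        (Computable.fst.comp (Computable.snd.comp .snd) :
          Computable fun p : ℕ × List Bool × ℕ × ℕ => p.2.2.1) Computable.fst
      exact this
    have hn : IsComputableRat fun p : ℕ × List Bool × ℕ × ℕ => h p.1 p.2.1 :=
      hh.comp (h := fun p : ℕ × List Bool × ℕ × ℕ => (p.1, p.2.1))
        (Computable.fst.pair (Computable.fst.comp .snd))
    refine ⟨_, _, .cond hkl (.cond hkn hn (.const 0)) (.const 0), .const 0, fun p => ?_⟩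
    dsimp only
    rw [smul_apply, inner_smul_right, inner_initialProjection he.2.1]
    simp only [Bool.cond_decide, ite_and]
    split_ifs <;> simp

end Scalar

theorem mainTheorem4 {X : Type*} [NormedAddCommGroup X] [InnerProductSpace ℂ X]
    [CompleteSpace X] (hX : ¬ FiniteDimensional ℂ X)
    (φ : ComputabilityStructure X) (hφ : φ.EffectivelySeparable)
    (M : List Bool → X →L[ℂ] X) (hM : IsUniversalSemiPOVM φ M)
    (x : X) (hx : φ.IsComputablePoint x) (hx1 : ‖x‖ = 1) :
    ∃ m : List Bool → ℝ, (∀ s, (m s : ℂ) = inner ℂ x (M s x)) ∧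
      IsUniversalProbability m := by
  obtain ⟨hlow, huniv⟩ := hM
  refine ⟨fun s => (inner ℂ x (M s x)).re, fun s => (hlow.1.1 s).ofReal_re_inner x,
    hlow.isLowerComputableSemimeasure hx hx1, fun r hr => ?_⟩
  obtain ⟨e, he, -⟩ := hlow.2
  obtain ⟨c, hc, hcM⟩ := huniv _ (hr.isLowerComputableSemiPOVM_smul_one he)
  refine ⟨c, hc, fun s => ?_⟩
  simpa [inner_smul_right, hx1] using re_inner_le_of_le (hcM s) x
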